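/- Theorem (Dirichlet polynomials dense in $H(\Omega)$, $\Omega$ simply connected): Let $\Omega\subset\mathbb{C}$ be an open simply connected set, and let $H(\Omega)$ be the space of holomorphic functions $f:\Omega\to\mathbb{C}$, endowed with the topology of uniform convergence on compact subsets of $\Omega$. Then the (restrictions to $\Omega$ of) Dirichlet polynomials, that is, the functions of the form $P(s)=\sum_{n=1}^{N}a_n n^{-s}$ with $N\in\mathbb{N}$ and $a_1,\dots,a_N\in\mathbb{C}$, are dense in $H(\Omega)$. -/

import Mathlib

/-- The space `H(Ω)` of holomorphic functions on a set `Ω ⊆ ℂ` (used for `Ω` open), as a subspace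
of the space `C(Ω, ℂ)` of continuous functions. The topology is the one induced by the compact-open
topology of `C(Ω, ℂ)`, that is, the topology of uniform convergence on compact subsets of `Ω`. -/
def HolomorphicSpace (Ω : Set ℂ) : Submodule ℂ C(Ω, ℂ) where
  carrier := {f | ∃ F : ℂ → ℂ, DifferentiableOn ℂ F Ω ∧ ∀ z : Ω, f z = F z}
  zero_mem' := ⟨fun _ => 0, differentiableOn_const 0, fun _ => rfl⟩
  add_mem' := by
    rintro f g ⟨F, hF, hf⟩ ⟨G, hG, hg⟩
    exact ⟨fun z => F z + G z, hF.add hG, fun z => by simp [hf z, hg z]⟩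
  smul_mem' := by
    rintro c f ⟨F, hF, hf⟩
    exact ⟨fun z => c * F z, hF.const_mul c, fun z => by simp [hf z]⟩

/-- The Dirichlet polynomial `s ↦ ∑_{n=1}^{N} a_n n^{-s}`. -/
noncomputable def dirichletPolynomial (N : ℕ) (a : ℕ → ℂ) (s : ℂ) : ℂ :=
  ∑ n ∈ Finset.Icc 1 N, a n * (n : ℂ) ^ (-s)

/-- The set of (restrictions to `Ω` of) Dirichlet polynomials, inside `H(Ω)`. -/
def dirichletPolynomials (Ω : Set ℂ) : Set (HolomorphicSpace Ω) :=
  {f | ∃ (N : ℕ) (a : ℕ → ℂ), ∀ s : Ω, (f : C(Ω, ℂ)) s = dirichletPolynomial N a s}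

/-!
By Runge's theorem, a holomorphic function on `Ω` is approximated on a compact set `K` by
polynomials as soon as filling the holes of `K` does not leave `Ω`: cut the function off outside a
neighbourhood of the filled set and represent it on `K`, by the Cauchy–Pompeiu formula, as an
integral of functions `(w - z)⁻¹` with `w` outside the filled set; each of these lies in the closed
algebra generated by `z`, because the spectrum of `z` in that algebra is contained in the filled
set. A hole of `K` cannot contain a point `a ∉ Ω` when `Ω` is simply connected, since `z - a` has a
logarithm on `K`, while around a hole containing `a` it has winding number one.

Dirichlet polynomials approximate polynomials by duality. If a continuous functional `L` on `C(K)`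
kills every `n ^ (-z)`, then the entire function `t ↦ L (exp (t z))` of exponential type vanishes at
all points `-log n`. These are exponentially dense, too many zeros for a nonzero function of
exponential type, so it vanishes identically, and its derivatives at `0` are the values `L (z ^ k)`.
-/

open Complex Filter MeasureTheory Metric Set Topology

section Zeros

variable {E : Type*} [NormedAddCommGroup E] [NormedSpace ℂ E] [CompleteSpace E] {F : ℂ → E}
  {S : Finset ℂ}

theorem exists_differentiable_eq_prod_sub_smul (hF : Differentiable ℂ F)
    (hzero : ∀ a ∈ S, F a = 0) :
    ∃ G : ℂ → E, Differentiable ℂ G ∧ ∀ z, F z = (∏ a ∈ S, (z - a)) • G z := by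
  induction S using Finset.induction_on with
  | empty => exact ⟨F, hF, by simp⟩
  | insert b S hb ih =>
    obtain ⟨G, hG, hFG⟩ := ih fun a ha => hzero a (Finset.mem_insert_of_mem ha)
    have hprod : ∏ a ∈ S, (b - a) ≠ 0 :=
      Finset.prod_ne_zero_iff.mpr fun a ha => sub_ne_zero.mpr (ne_of_mem_of_not_mem ha hb).symm
    have hGb : G b = 0 := (smul_eq_zero_iff_right hprod).mp <|
      (hFG b).symm.trans (hzero b (Finset.mem_insert_self b S))
    refine ⟨dslope G b, ?_, fun z => ?_⟩
    · rw [← differentiableOn_univ] at hG ⊢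
      exact (differentiableOn_dslope univ_mem).mpr hG
    · rw [Finset.prod_insert hb, mul_comm, mul_smul, sub_smul_dslope, hGb, sub_zero, hFG]

theorem norm_le_mul_pow_card_of_zeros (hF : Differentiable ℂ F) (hzero : ∀ a ∈ S, F a = 0)
    {r R M : ℝ} (hrR : r < R) (hS : ∀ a ∈ S, ‖a‖ ≤ r) (hM : ∀ w ∈ sphere 0 R, ‖F w‖ ≤ M)
    {z : ℂ} (hz : ‖z‖ ≤ r) : ‖F z‖ ≤ M * (2 * r / (R - r)) ^ S.card := by
  obtain ⟨G, hG, hFG⟩ := exists_differentiable_eq_prod_sub_smul hF hzero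
  have hR : 0 < R := ((norm_nonneg z).trans hz).trans_lt hrR
  have hgap : 0 < (R - r) ^ S.card := pow_pos (sub_pos.mpr hrR) _
  have hG_sphere : ∀ w ∈ sphere 0 R, ‖G w‖ ≤ M / (R - r) ^ S.card := fun w hw => by
    rw [le_div_iff₀' hgap]
    refine le_trans ?_ (hM w hw)
    rw [hFG w, norm_smul, norm_prod]
    gcongr
    rw [← Finset.prod_const]
    refine Finset.prod_le_prod (fun _ _ => (sub_pos.mpr hrR).le) fun a ha => ?_
    linarith [norm_sub_norm_le w a, hS a ha, mem_sphere_zero_iff_norm.mp hw]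
  have hG_le : ‖G z‖ ≤ M / (R - r) ^ S.card :=
    norm_le_of_forall_mem_frontier_norm_le isBounded_ball hG.diffContOnCl
      (frontier_ball (0 : ℂ) hR.ne' ▸ hG_sphere)
      (subset_closure (mem_ball_zero_iff.mpr (hz.trans_lt hrR)))
  have hprod_le : ∏ a ∈ S, ‖z - a‖ ≤ (2 * r) ^ S.card := by
    rw [← Finset.prod_const]
    exact Finset.prod_le_prod (fun _ _ => norm_nonneg _) fun a ha => by
      linarith [norm_sub_le z a, hS a ha]
  calc ‖F z‖ = (∏ a ∈ S, ‖z - a‖) * ‖G z‖ := by rw [hFG z, norm_smul, norm_prod]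
    _ ≤ (2 * r) ^ S.card * (M / (R - r) ^ S.card) :=
      mul_le_mul hprod_le hG_le (norm_nonneg _)
        ((Finset.prod_nonneg fun _ _ => norm_nonneg _).trans hprod_le)
    _ = M * (2 * r / (R - r)) ^ S.card := by rw [div_pow]; ring

theorem injective_neg_log_natCast_add_one :
    Function.Injective fun n : ℕ => -(Real.log (n + 1) : ℂ) := by
  intro m n h
  have hlog : Real.log (m + 1) = Real.log (n + 1) := by exact_mod_cast neg_injective h
  have := Real.log_injOn_pos (mem_Ioi.mpr m.cast_add_one_pos) (mem_Ioi.mpr n.cast_add_one_pos) hlog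
  exact_mod_cast add_right_cancel this

theorem norm_neg_log_natCast_add_one_le {n N : ℕ} (hn : n < N) :
    ‖-(Real.log (n + 1) : ℂ)‖ ≤ Real.log N := by
  rw [norm_neg, norm_real, Real.norm_of_nonneg (Real.log_nonneg (by simp))]
  exact Real.log_le_log n.cast_add_one_pos (by exact_mod_cast hn)

theorem exp_mul_log_le_pow_ceil {x : ℝ} (hx : 1 ≤ x) (c : ℝ) :
    Real.exp (c * Real.log x) ≤ x ^ ⌈c⌉₊ :=
  calc Real.exp (c * Real.log x) = x ^ c := by
        rw [Real.rpow_def_of_pos (one_pos.trans_le hx), mul_comm]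
    _ ≤ x ^ (⌈c⌉₊ : ℝ) := Real.rpow_le_rpow_of_exponent_le hx (Nat.le_ceil c)
    _ = x ^ ⌈c⌉₊ := Real.rpow_natCast x _

/- The disc of radius `log N` contains `N` of the zeros, whereas exponential type lets `F` grow
only like a power of `N` there. -/
theorem eq_zero_of_exponentialType_of_neg_log_zeros (hF : Differentiable ℂ F) {C R : ℝ}
    (hC : ∀ z, ‖F z‖ ≤ C * Real.exp (R * ‖z‖))
    (hzero : ∀ n : ℕ, F (-(Real.log (n + 1) : ℂ)) = 0) : F = 0 := by
  have hC_nonneg : 0 ≤ C := by simpa using (norm_nonneg _).trans (hC 0)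
  have hdecay : Tendsto (fun N : ℕ => C * (((N : ℝ) ^ ⌈5 * R⌉₊) * (1 / 2) ^ N)) atTop (𝓝 0) := by
    simpa using (tendsto_pow_const_mul_const_pow_of_abs_lt_one ⌈5 * R⌉₊
      (by norm_num [abs_of_pos] : |(1 / 2 : ℝ)| < 1)).const_mul C
  have hlog : Tendsto (fun N : ℕ => Real.log N) atTop atTop :=
    Real.tendsto_log_atTop.comp tendsto_natCast_atTop_atTop
  ext z
  refine norm_le_zero_iff.mp (ge_of_tendsto hdecay ?_)
  filter_upwards [hlog.eventually_ge_atTop ‖z‖, hlog.eventually_gt_atTop 0,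
    eventually_ge_atTop 1] with N hzN hlogN hN
  have hM : ∀ w ∈ sphere 0 (5 * Real.log N), ‖F w‖ ≤ C * (N : ℝ) ^ ⌈5 * R⌉₊ := fun w hw => by
    refine (hC w).trans (mul_le_mul_of_nonneg_left ?_ hC_nonneg)
    rw [mem_sphere_zero_iff_norm.mp hw, ← mul_assoc, mul_comm R]
    exact exp_mul_log_le_pow_ceil (by exact_mod_cast hN) _
  have hbound := norm_le_mul_pow_card_of_zeros hF (r := Real.log N)
    (S := (Finset.range N).map ⟨_, injective_neg_log_natCast_add_one⟩)
    (Finset.forall_mem_map.mpr fun n _ => hzero n) (by linarith)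
    (Finset.forall_mem_map.mpr fun n hn =>
      norm_neg_log_natCast_add_one_le (Finset.mem_range.mp hn)) hM hzN
  have hratio : 2 * Real.log N / (5 * Real.log N - Real.log N) = 1 / 2 := by
    field_simp
    norm_num
  rwa [Finset.card_map, Finset.card_range, hratio, mul_assoc] at hbound

end Zeros

theorem mem_of_forall_dual_eq_zero {𝕜 E : Type*} [RCLike 𝕜] [NormedAddCommGroup E]
    [NormedSpace 𝕜 E] {S : Submodule 𝕜 E} (hS : IsClosed (S : Set E)) {x : E}
    (h : ∀ L : E →L[𝕜] 𝕜, (∀ y ∈ S, L y = 0) → L x = 0) : x ∈ S := by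
  have := hS
  rw [← Submodule.Quotient.mk_eq_zero S]
  refine SeparatingDual.eq_zero_of_forall_dual_eq_zero (R := 𝕜) fun L => ?_
  refine h (L.comp S.mkQL) fun y hy => ?_
  simp [(Submodule.Quotient.mk_eq_zero S).mpr hy]

section Exponentials

open NormedSpace

variable {A : Type*} [NormedRing A] [NormedAlgebra ℂ A]

theorem norm_exp_le_norm_one_mul_exp_norm (x : A) :
    ‖exp x‖ ≤ ‖(1 : A)‖ * Real.exp ‖x‖ := by
  have hpow (n : ℕ) : ‖x ^ n‖ ≤ ‖(1 : A)‖ * ‖x‖ ^ n := by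
    induction n with
    | zero => simp
    | succ n ih =>
      calc ‖x ^ (n + 1)‖ ≤ ‖x ^ n‖ * ‖x‖ := pow_succ x n ▸ norm_mul_le _ _
        _ ≤ ‖(1 : A)‖ * ‖x‖ ^ (n + 1) := by rw [pow_succ, ← mul_assoc]; gcongr
  rw [exp_eq_tsum ℂ, Real.exp_eq_exp_ℝ]
  refine tsum_of_norm_bounded ((expSeries_div_hasSum_exp ‖x‖).mul_left _) fun n => ?_
  rw [norm_smul, norm_inv, Complex.norm_natCast, mul_div_assoc', div_eq_inv_mul]
  gcongr
  exact hpow n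

theorem pow_mem_closure_span_exp_neg_log_smul [CompleteSpace A] (x : A) (k : ℕ) :
    x ^ k ∈ (Submodule.span ℂ
      (range fun n : ℕ => exp (-(Real.log (n + 1) : ℂ) • x))).topologicalClosure := by
  refine mem_of_forall_dual_eq_zero (Submodule.isClosed_topologicalClosure _) fun L hL => ?_
  let _ : NormedAlgebra ℚ A := NormedAlgebra.restrictScalars ℚ ℂ A
  have hderiv (k : ℕ) (t : ℂ) :
      HasDerivAt (fun t : ℂ => L (x ^ k * exp (t • x))) (L (x ^ (k + 1) * exp (t • x))) t := by
    rw [pow_succ, mul_assoc]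
    exact L.hasFDerivAt.comp_hasDerivAt t ((hasDerivAt_exp_smul_const' x t).const_mul (x ^ k))
  have htype (t : ℂ) : ‖L (exp (t • x))‖ ≤ ‖L‖ * ‖(1 : A)‖ * Real.exp (‖x‖ * ‖t‖) := by
    rw [mul_assoc, mul_comm ‖x‖, ← norm_smul]
    exact (L.le_opNorm _).trans (by gcongr; exact norm_exp_le_norm_one_mul_exp_norm _)
  have hexp : (fun t : ℂ => L (exp (t • x))) = 0 :=
    eq_zero_of_exponentialType_of_neg_log_zeros
      (fun t => by simpa using (hderiv 0 t).differentiableAt) htype fun n =>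
        hL _ (Submodule.le_topologicalClosure _ (Submodule.subset_span ⟨n, rfl⟩))
  have hpow_exp (k : ℕ) : (fun t : ℂ => L (x ^ k * exp (t • x))) = 0 := by
    induction k with
    | zero => simpa using hexp
    | succ k ih =>
      ext t
      have hconst := hderiv k t
      rw [ih] at hconst
      exact hconst.unique (hasDerivAt_const t 0)
  simpa using congrFun (hpow_exp k) 0

end Exponentials

theorem frontier_connectedComponentIn_compl_subset {X : Type*} [TopologicalSpace X]
    [LocallyConnectedSpace X] {K : Set X} (hK : IsClosed K) (a : X) :
    frontier (connectedComponentIn Kᶜ a) ⊆ K := by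
  intro x hx
  by_contra hxK
  have hopen (y : X) : IsOpen (connectedComponentIn Kᶜ y) := hK.isOpen_compl.connectedComponentIn
  obtain ⟨y, hyx, hya⟩ :=
    mem_closure_iff.mp hx.1 _ (hopen x) (mem_connectedComponentIn hxK)
  have heq : connectedComponentIn Kᶜ x = connectedComponentIn Kᶜ a :=
    (connectedComponentIn_eq hyx).trans (connectedComponentIn_eq hya).symm
  refine hx.2 ?_
  rw [(hopen a).interior_eq, ← heq]
  exact mem_connectedComponentIn hxK

/-- The set obtained from `K ⊆ ℂ` by filling its holes, that is, by adding to `K` the bounded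
connected components of its complement; for compact `K` this is the polynomially convex hull of
`K`. A point of `K` satisfies the condition because its component in `Kᶜ` is `∅` by convention. -/
def fillHoles (K : Set ℂ) : Set ℂ :=
  {z | Bornology.IsBounded (connectedComponentIn Kᶜ z)}

theorem mem_fillHoles {K : Set ℂ} {z : ℂ} :
    z ∈ fillHoles K ↔ Bornology.IsBounded (connectedComponentIn Kᶜ z) :=
  Iff.rfl

theorem subset_fillHoles (K : Set ℂ) : K ⊆ fillHoles K := fun z hz => by
  rw [mem_fillHoles, connectedComponentIn_eq_empty (notMem_compl_iff.mpr hz)]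
  exact Bornology.isBounded_empty

theorem isClosed_fillHoles {K : Set ℂ} (hK : IsClosed K) : IsClosed (fillHoles K) := by
  rw [← isOpen_compl_iff, isOpen_iff_forall_mem_open]
  intro z hz
  refine ⟨connectedComponentIn Kᶜ z, fun w hw hw_fill => hz ?_,
    hK.isOpen_compl.connectedComponentIn,
    mem_connectedComponentIn fun hzK => hz (subset_fillHoles K hzK)⟩
  rwa [mem_fillHoles, connectedComponentIn_eq hw]

/- The maximum principle for the identity function on a hole of `K`. -/
theorem fillHoles_subset_closedBall {K : Set ℂ} (hK : IsClosed K) {r : ℝ}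
    (hKr : K ⊆ closedBall 0 r) : fillHoles K ⊆ closedBall 0 r := fun z hz => by
  by_cases hzK : z ∈ K
  · exact hKr hzK
  · exact mem_closedBall_zero_iff.mpr <|
      norm_le_of_forall_mem_frontier_norm_le (f := id) (mem_fillHoles.mp hz)
        differentiable_id.diffContOnCl
        (fun w hw => mem_closedBall_zero_iff.mp <|
          hKr (frontier_connectedComponentIn_compl_subset hK z hw))
        (subset_closure (mem_connectedComponentIn hzK))

theorem isCompact_fillHoles {K : Set ℂ} (hK : IsCompact K) : IsCompact (fillHoles K) := by
  obtain ⟨r, hKr⟩ := hK.isBounded.subset_closedBall 0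
  exact (isCompact_closedBall 0 r).of_isClosed_subset (isClosed_fillHoles hK.isClosed)
    (fillHoles_subset_closedBall hK.isClosed hKr)

/- On the circle, `θ ↦ l (a + r e^{iθ})` and `θ ↦ l (a + r) + iθ` lift the same path through `exp`,
but only the former has period `2π`. -/
theorem not_eqOn_exp_comp_sub_sphere {l : ℂ → ℂ} {a : ℂ} {r : ℝ} (hr : 0 < r)
    (hl : ContinuousOn l (sphere a r)) : ¬ EqOn (exp ∘ l) (· - a) (sphere a r) := by
  intro hexp
  have hcircle (θ : ℝ) : exp (l (circleMap a r θ)) = r * exp (θ * I) := by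
    simpa [circleMap] using hexp (circleMap_mem_sphere a hr.le θ)
  have hlift : (fun θ : ℝ => l (circleMap a r θ)) = fun θ : ℝ => l (circleMap a r 0) + θ * I := by
    refine isCoveringMap_exp.eq_of_comp_eq
      (hl.comp_continuous (continuous_circleMap a r) (circleMap_mem_sphere a hr.le))
      (by fun_prop) (funext fun θ => Subtype.ext ?_) 0 (by simp)
    simp [exp_add, hcircle]
  have hperiod := congrFun hlift (2 * Real.pi)
  rw [← zero_add (2 * Real.pi), periodic_circleMap a r 0] at hperiod
  simp [Real.pi_ne_zero] at hperiod

/- Glueing a logarithm of `z - a` on the component of `a` to `z - a` itself elsewhere gives a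
zero-free function on `ℂ`, whose logarithm would restrict to one of `z - a` on large circles. -/
theorem notMem_fillHoles_of_eqOn_exp_comp_sub {K : Set ℂ} (hK : IsClosed K) {a : ℂ} (ha : a ∉ K)
    {g : ℂ → ℂ} (hg : ContinuousOn g K) (hexp : EqOn (exp ∘ g) (· - a) K) :
    a ∉ fillHoles K := by
  classical
  intro hbounded
  set U := connectedComponentIn Kᶜ a
  have haU : a ∈ U := mem_connectedComponentIn ha
  obtain ⟨G, hG⟩ := ContinuousMap.exists_restrict_eq hK
    ⟨K.domRestrict g, continuousOn_iff_continuous_domRestrict.mp hg⟩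
  have hGK (z : ℂ) (hz : z ∈ K) : exp (G z) = z - a :=
    (congrArg exp (DFunLike.congr_fun hG ⟨z, hz⟩)).trans (hexp hz)
  have hglue : Continuous (U.piecewise (fun z => exp (G z)) (· - a)) :=
    Continuous.piecewise
      (fun z hz => hGK z (frontier_connectedComponentIn_compl_subset hK a hz))
      (by fun_prop) (by fun_prop)
  have hne_zero : (0 : ℂ) ∉ U.piecewise (fun z => exp (G z)) (· - a) '' univ := by
    rintro ⟨z, -, hz⟩
    by_cases hzU : z ∈ U
    · simp [hzU] at hz
    · rw [piecewise_eq_of_notMem _ _ _ hzU, sub_eq_zero] at hz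
      exact hzU (hz ▸ haU)
  have huniv : IsSimplyConnected (univ : Set ℂ) :=
    (Homeomorph.Set.univ ℂ).toHomotopyEquiv.simplyConnectedSpace_iff.mpr inferInstance
  obtain ⟨l, hl, hl_exp⟩ :=
    exists_continuousOn_eqOn_exp_comp huniv isOpen_univ hglue.continuousOn hne_zero
  obtain ⟨r, hr, hUr⟩ := (mem_fillHoles.mp hbounded).subset_ball_lt 0 a
  refine not_eqOn_exp_comp_sub_sphere hr (hl.mono (subset_univ (sphere a r))) fun z hz => ?_
  have hzU : z ∉ U := fun hzU => (mem_ball.mp (hUr hzU)).ne hz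
  exact (hl_exp (mem_univ z)).trans (piecewise_eq_of_notMem _ _ _ hzU)

theorem fillHoles_subset_of_isSimplyConnected {Ω K : Set ℂ} (hΩ : IsOpen Ω)
    (hsc : IsSimplyConnected Ω) (hK : IsClosed K) (hKΩ : K ⊆ Ω) : fillHoles K ⊆ Ω := by
  intro a ha_fill
  by_contra ha
  obtain ⟨g, hg, hexp⟩ := exists_continuousOn_eqOn_exp_comp hsc hΩ (g := (· - a)) (by fun_prop)
    fun ⟨z, hz, hza⟩ => ha (sub_eq_zero.mp hza ▸ hz)
  exact notMem_fillHoles_of_eqOn_exp_comp_sub hK (fun haK => ha (hKΩ haK)) (hg.mono hKΩ)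
    (hexp.mono hKΩ) ha_fill

section CauchyPompeiu

open scoped ComplexConjugate

variable {E : Type*} [NormedAddCommGroup E] [NormedSpace ℂ E] {u v : ℂ → E} {w : ℂ}

/-- The Wirtinger derivative `∂u/∂z̄ = (∂u/∂x + i ∂u/∂y) / 2`, the obstruction to holomorphy that
appears in the Cauchy–Pompeiu formula. -/
noncomputable def dbar (u : ℂ → E) (w : ℂ) : E :=
  (2⁻¹ : ℂ) • (fderiv ℝ u w 1 + I • fderiv ℝ u w I)

theorem dbar_congr (h : u =ᶠ[𝓝 w] v) : dbar u w = dbar v w := by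
  rw [dbar, h.fderiv_eq, dbar]

theorem dbar_eq_zero_of_differentiableAt (h : DifferentiableAt ℂ u w) : dbar u w = 0 := by
  have hI : fderiv ℂ u w I = I • fderiv ℂ u w 1 := by rw [← map_smul, smul_eq_mul, mul_one]
  rw [dbar, h.fderiv_restrictScalars ℝ]
  simp [hI, smul_smul]

theorem continuous_dbar (hu : ContDiff ℝ 1 u) : Continuous (dbar u) := by
  have := hu.continuous_fderiv one_ne_zero
  unfold dbar
  fun_prop

theorem tsupport_dbar_subset (u : ℂ → E) : tsupport (dbar u) ⊆ tsupport u :=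
  closure_minimal (fun w hw => by_contra fun hw_supp => hw <| by
    simp [dbar, fderiv_of_notMem_tsupport ℝ hw_supp]) (isClosed_tsupport u)

theorem conj_smul_dbar (u : ℂ → E) (w ζ : ℂ) :
    conj ζ • dbar u w = (2⁻¹ : ℂ) • (fderiv ℝ u w ζ + I • fderiv ℝ u w (I * ζ)) := by
  have hmap (a b : ℝ) :
      fderiv ℝ u w (a + b * I) = (a : ℂ) • fderiv ℝ u w 1 + (b : ℂ) • fderiv ℝ u w I := by
    have : (a + b * I : ℂ) = a • (1 : ℂ) + b • I := by simp
    rw [this, map_add, map_smul, map_smul, coe_smul, coe_smul]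
  have hIζ : I * ζ = ((-ζ.im : ℝ) : ℂ) + ζ.re * I := by
    apply Complex.ext <;> simp
  have hconj : conj ζ = ζ.re - ζ.im * I := by
    apply Complex.ext <;> simp
  have hζ : fderiv ℝ u w ζ = (ζ.re : ℂ) • fderiv ℝ u w 1 + (ζ.im : ℂ) • fderiv ℝ u w I := by
    rw [← hmap, re_add_im]
  rw [hIζ, hmap, hζ, hconj, dbar]
  push_cast
  match_scalars
  · ring
  · linear_combination (-2⁻¹ * ζ.im : ℂ) * I_mul_I

theorem integrableOn_fderiv_circleMap (hu : ContDiff ℝ 1 u) (hc : HasCompactSupport u) (z : ℂ)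
    {ζ : ℝ → ℂ} (hζ : Continuous ζ) :
    IntegrableOn (fun p : ℝ × ℝ => fderiv ℝ u (circleMap z p.1 p.2) (ζ p.2))
      polarCoord.target := by
  obtain ⟨R, hR⟩ := hc.isCompact.isBounded.subset_closedBall z
  have hcont : Continuous fun p : ℝ × ℝ => fderiv ℝ u (circleMap z p.1 p.2) :=
    (hu.continuous_fderiv one_ne_zero).comp (by fun_prop)
  have hzero (p : ℝ × ℝ) (hp : R < |p.1|) : fderiv ℝ u (circleMap z p.1 p.2) = 0 :=
    fderiv_of_notMem_tsupport ℝ fun hsupp =>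
      hp.not_ge ((circleMap_mem_sphere' z p.1 p.2).symm.trans_le (hR hsupp))
  refine IntegrableOn.of_forall_sdiff_eq_zero (s := Icc 0 R ×ˢ Icc (-Real.pi) Real.pi)
    ((hcont.clm_apply (hζ.comp continuous_snd)).continuousOn.integrableOn_compact
      (isCompact_Icc.prod isCompact_Icc))
    polarCoord.open_target.measurableSet ?_
  rintro p ⟨⟨hp_pos, hp⟩, hp_notMem⟩
  have hRp : R < p.1 := not_le.mp fun hpR =>
    hp_notMem ⟨⟨(mem_Ioi.mp hp_pos).le, hpR⟩, Ioo_subset_Icc_self hp⟩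
  simp only [hzero p (hRp.trans_le (le_abs_self _)), zero_apply]

variable [CompleteSpace E]

theorem integral_Ioi_fderiv_circleMap (hu : ContDiff ℝ 1 u) (hc : HasCompactSupport u) (z : ℂ)
    (θ : ℝ) : ∫ r in Ioi (0 : ℝ), fderiv ℝ u (circleMap z r θ) (exp (θ * I)) = -u z := by
  have hray (r : ℝ) : HasDerivAt (fun r : ℝ => circleMap z r θ) (exp (θ * I)) r := by
    simpa [circleMap] using (ofRealCLM.hasDerivAt.mul_const (exp (θ * I))).const_add z
  have hderiv : deriv (fun r : ℝ => u (circleMap z r θ)) =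
      fun r : ℝ => fderiv ℝ u (circleMap z r θ) (exp (θ * I)) := funext fun r =>
    ((hu.differentiable one_ne_zero _).hasFDerivAt.comp_hasDerivAt r (hray r)).deriv
  obtain ⟨R, hR⟩ := hc.isCompact.isBounded.subset_closedBall z
  have hsupp : HasCompactSupport fun r : ℝ => u (circleMap z r θ) := by
    refine HasCompactSupport.intro (isCompact_closedBall 0 R) fun r hr => ?_
    refine image_eq_zero_of_notMem_tsupport fun hsupp => hr ?_
    rw [mem_closedBall_zero_iff, Real.norm_eq_abs]
    exact (circleMap_mem_sphere' z r θ).symm.trans_le (hR hsupp)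
  rw [← hderiv, HasCompactSupport.integral_Ioi_deriv_eq _ hsupp]
  · simp
  · exact hu.comp (contDiff_const.add (ofRealCLM.contDiff.mul contDiff_const))

theorem integral_Ioo_fderiv_circleMap (hu : ContDiff ℝ 1 u) (z : ℂ) {r : ℝ} (hr : r ≠ 0) :
    ∫ θ in Ioo (-Real.pi) Real.pi, fderiv ℝ u (circleMap z r θ) (I * exp (θ * I)) = 0 := by
  have hcircle (θ : ℝ) : HasDerivAt (fun θ : ℝ => r⁻¹ • u (circleMap z r θ))
      (fderiv ℝ u (circleMap z r θ) (I * exp (θ * I))) θ := by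
    refine (((hu.differentiable one_ne_zero _).hasFDerivAt.comp_hasDerivAt θ
      (hasDerivAt_circleMap z r θ)).const_smul r⁻¹).congr_deriv ?_
    rw [← map_smul, circleMap_zero, real_smul, ofReal_inv, mul_assoc,
      inv_mul_cancel_left₀ (ofReal_ne_zero.mpr hr), mul_comm I]
  have hcont : Continuous fun θ : ℝ => fderiv ℝ u (circleMap z r θ) (I * exp (θ * I)) :=
    ((hu.continuous_fderiv one_ne_zero).comp (continuous_circleMap z r)).clm_apply (by fun_prop)
  rw [← integral_Ioc_eq_integral_Ioo, ← intervalIntegral.integral_of_le (by linarith [Real.pi_pos]),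
    intervalIntegral.integral_eq_sub_of_hasDerivAt (fun θ _ => hcircle θ)
      (hcont.intervalIntegrable _ _)]
  simp [circleMap, exp_neg]

theorem integral_fderiv_circleMap_radial (hu : ContDiff ℝ 1 u) (hc : HasCompactSupport u)
    (z : ℂ) : ∫ p in polarCoord.target, fderiv ℝ u (circleMap z p.1 p.2) (exp (p.2 * I)) =
      -(2 * Real.pi : ℂ) • u z := by
  have hint := integrableOn_fderiv_circleMap hu hc z (ζ := fun θ => exp (θ * I)) (by fun_prop)
  rw [polarCoord_target, Measure.volume_eq_prod, IntegrableOn, ← Measure.prod_restrict] at hint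
  rw [polarCoord_target, Measure.volume_eq_prod, ← Measure.prod_restrict, integral_prod_symm _ hint]
  simp only [integral_Ioi_fderiv_circleMap hu hc, setIntegral_const,
    Real.volume_real_Ioo_of_le (neg_le_self Real.pi_pos.le)]
  rw [← coe_smul, smul_neg, ← neg_smul]
  push_cast
  ring_nf

theorem integral_fderiv_circleMap_angular (hu : ContDiff ℝ 1 u) (hc : HasCompactSupport u)
    (z : ℂ) : ∫ p in polarCoord.target, fderiv ℝ u (circleMap z p.1 p.2) (I * exp (p.2 * I)) =
      0 := by
  rw [polarCoord_target, Measure.volume_eq_prod, setIntegral_prod]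
  · exact setIntegral_eq_zero_of_forall_eq_zero fun r hr =>
      integral_Ioo_fderiv_circleMap hu z (ne_of_gt hr)
  · exact integrableOn_fderiv_circleMap hu hc z (ζ := fun θ => I * exp (θ * I)) (by fun_prop)

/- In polar coordinates around `z` the Jacobian cancels the singularity and the integrand becomes
half of `∂u/∂r + (i / r) ∂u/∂θ`. -/
theorem integral_inv_sub_smul_dbar (hu : ContDiff ℝ 1 u) (hc : HasCompactSupport u) (z : ℂ) :
    ∫ w, (w - z)⁻¹ • dbar u w = -(Real.pi : ℂ) • u z := by
  have hradial := integrableOn_fderiv_circleMap hu hc z (ζ := fun θ => exp (θ * I)) (by fun_prop)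
  have hangular :=
    integrableOn_fderiv_circleMap hu hc z (ζ := fun θ => I * exp (θ * I)) (by fun_prop)
  have hpolar (p : ℝ × ℝ) (hp : p ∈ polarCoord.target) :
      p.1 • (Complex.polarCoord.symm p)⁻¹ • dbar u (Complex.polarCoord.symm p + z) =
        (2⁻¹ : ℂ) • (fderiv ℝ u (circleMap z p.1 p.2) (exp (p.2 * I)) +
          I • fderiv ℝ u (circleMap z p.1 p.2) (I * exp (p.2 * I))) := by
    have hp_ne : (p.1 : ℂ) ≠ 0 := ofReal_ne_zero.mpr (ne_of_gt hp.1)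
    have hsymm : Complex.polarCoord.symm p = p.1 * exp (p.2 * I) := by
      rw [Complex.polarCoord_symm_apply, exp_mul_I, ofReal_cos, ofReal_sin]
    rw [← conj_smul_dbar, hsymm, add_comm, ← circleMap, ← coe_smul, smul_smul, mul_inv,
      mul_inv_cancel_left₀ hp_ne, ← exp_conj, ← exp_neg]
    simp
  calc ∫ w, (w - z)⁻¹ • dbar u w = ∫ w, w⁻¹ • dbar u (w + z) := by
        simpa using integral_sub_right_eq_self (fun w => w⁻¹ • dbar u (w + z)) z
    _ = ∫ p in polarCoord.target,
          (2⁻¹ : ℂ) • (fderiv ℝ u (circleMap z p.1 p.2) (exp (p.2 * I)) +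
            I • fderiv ℝ u (circleMap z p.1 p.2) (I * exp (p.2 * I))) := by
        rw [← Complex.integral_comp_polarCoord_symm]
        exact setIntegral_congr_fun polarCoord.open_target.measurableSet hpolar
    _ = -(Real.pi : ℂ) • u z := by
        rw [integral_smul, integral_add hradial (hangular.fun_smul I), integral_smul,
          integral_fderiv_circleMap_radial hu hc, integral_fderiv_circleMap_angular hu hc,
          smul_zero, add_zero, smul_smul]
        congr 1
        ring

end CauchyPompeiu

section Runge

theorem exists_contDiff_hasCompactSupport_eventuallyEq_nhdsSet {V F : Type*}
    [NormedAddCommGroup V] [NormedSpace ℝ V] [FiniteDimensional ℝ V] [NormedAddCommGroup F]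
    [NormedSpace ℝ F] {n : ℕ∞} {f : V → F} {Ω K : Set V} (hΩ : IsOpen Ω)
    (hf : ContDiffOn ℝ n f Ω) (hK : IsCompact K) (hKΩ : K ⊆ Ω) :
    ∃ u : V → F, ContDiff ℝ n u ∧ HasCompactSupport u ∧ u =ᶠ[𝓝ˢ K] f := by
  obtain ⟨t, ht, hKt, htΩ⟩ := exists_compact_between hK hΩ hKΩ
  obtain ⟨χ, hχ_one, hχ_zero, -⟩ := exists_contMDiffMap_one_nhds_of_subset_interior (n := n)
    (modelWithCornersSelf ℝ V) hK.isClosed hKt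
  have hχ_tsupport : tsupport χ ⊆ t :=
    closure_minimal (fun w hw => by_contra fun hwt => hw (hχ_zero w hwt)) ht.isClosed
  have hχ : HasCompactSupport χ := ht.of_isClosed_subset (isClosed_tsupport _) hχ_tsupport
  refine ⟨fun w => χ w • f w, contDiff_iff_contDiffAt.mpr fun w => ?_, hχ.smul_right, ?_⟩
  · by_cases hw : w ∈ tsupport χ
    · exact χ.contMDiff.contDiff.contDiffAt.smul
        (hf.contDiffAt (hΩ.mem_nhds (htΩ (hχ_tsupport hw))))
    · refine contDiffAt_const (c := 0) |>.congr_of_eventuallyEq ?_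
      filter_upwards [notMem_tsupport_iff_eventuallyEq.mp hw] with y hy
      simp [hy]
  · filter_upwards [hχ_one] with w hw
    simp [hw]

theorem integral_mem_of_isClosed_submodule {α 𝕜 E : Type*} [MeasurableSpace α] {μ : Measure α}
    [RCLike 𝕜] [NormedAddCommGroup E] [NormedSpace 𝕜 E] [NormedSpace ℝ E] [CompleteSpace E]
    {S : Submodule 𝕜 E} (hS : IsClosed (S : Set E)) {f : α → E} (hf : ∀ x, f x ∈ S) :
    ∫ x, f x ∂μ ∈ S := by
  refine mem_of_forall_dual_eq_zero hS fun L hL => ?_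
  by_cases hf_int : Integrable f μ
  · rw [← L.integral_comp_comm hf_int]
    simp [hL _ (hf _)]
  · rw [integral_undef hf_int, map_zero]

variable {K : Set ℂ}

theorem continuous_mul_inv_sub {p : ℂ → ℂ} (hp : Continuous p)
    (hpK : Disjoint K (tsupport p)) : Continuous fun q : ℂ × K => p q.1 * (q.1 - q.2)⁻¹ := by
  rw [continuous_iff_continuousAt]
  rintro ⟨w, z⟩
  by_cases h : w = z
  · have hw : w ∉ tsupport p := disjoint_left.mp hpK (h ▸ z.2)
    have hzero : (fun q : ℂ × K => p q.1 * (q.1 - q.2)⁻¹) =ᶠ[𝓝 (w, z)] fun _ => 0 := by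
      filter_upwards [continuousAt_fst.eventually (notMem_tsupport_iff_eventuallyEq.mp hw)]
        with q hq
      simp [hq]
    exact hzero.continuousAt
  · refine (hp.comp continuous_fst).continuousAt.mul (ContinuousAt.inv₀ ?_ (sub_ne_zero.mpr h))
    fun_prop

variable [CompactSpace K]

/- Enlarging a closed subalgebra can only fill holes of the spectrum, and the spectrum of the
coordinate in `C(K, ℂ)` is `K`. -/
theorem inv_sub_mem_closure_polynomialFunctions {w : ℂ} (hw : w ∉ fillHoles K) {g : C(K, ℂ)}
    (hg : ∀ z : K, g z = (w - z)⁻¹) : g ∈ (polynomialFunctions K).topologicalClosure := by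
  set S := (polynomialFunctions K).topologicalClosure
  have : IsClosed (S : Set C(K, ℂ)) := Subalgebra.isClosed_topologicalClosure _
  let x : S := ⟨Polynomial.X.toContinuousMapOn K,
    Subalgebra.le_topologicalClosure _ ⟨Polynomial.X, trivial, rfl⟩⟩
  have hspec : w ∉ spectrum ℂ x := fun h => hw <| by
    have := Subalgebra.spectrum_isBounded_connectedComponentIn S x h
    simpa [x, mem_fillHoles, ContinuousMap.spectrum_eq_range, Set.range] using this
  obtain ⟨y, hy⟩ := (spectrum.notMem_iff.mp hspec).exists_left_inv
  have hyg : (y : C(K, ℂ)) = g := by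
    ext z
    have hyz : (y : C(K, ℂ)) z * (w - z) = 1 := by
      simpa [x, Algebra.algebraMap_eq_smul_one] using congrArg (fun f : S => (f : C(K, ℂ)) z) hy
    rw [hg z]
    exact eq_inv_of_mul_eq_one_left hyz
  exact hyg ▸ y.2

theorem cauchyTransform_mem_closure_polynomialFunctions {p : ℂ → ℂ} (hp : Continuous p)
    (hpc : HasCompactSupport p) (hpK : Disjoint (fillHoles K) (tsupport p)) {g : C(K, ℂ)}
    (hg : ∀ z : K, g z = ∫ w, p w * (w - z)⁻¹) :
    g ∈ (polynomialFunctions K).topologicalClosure := by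
  set S := (polynomialFunctions K).topologicalClosure
  let G : C(ℂ, C(K, ℂ)) := ContinuousMap.curry
    ⟨_, continuous_mul_inv_sub hp (hpK.mono_left (subset_fillHoles K))⟩
  have hG (w : ℂ) (z : K) : G w z = p w * (w - z)⁻¹ := rfl
  have hG_zero {w : ℂ} (hw : p w = 0) : G w = 0 := by
    ext z
    simp [hG, hw]
  have hG_mem (w : ℂ) : G w ∈ S.toSubmodule := by
    by_cases hw : p w = 0
    · exact hG_zero hw ▸ zero_mem _
    · rw [← smul_inv_smul₀ hw (G w)]
      refine S.smul_mem (inv_sub_mem_closure_polynomialFunctions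
        (fun hwK => disjoint_left.mp hpK hwK (subset_tsupport p hw)) fun z => ?_) _
      rw [ContinuousMap.smul_apply, hG, smul_eq_mul, inv_mul_cancel_left₀ hw]
  have hG_int : Integrable G := by
    refine G.continuous.integrable_of_hasCompactSupport (HasCompactSupport.intro hpc fun w hw => ?_)
    exact hG_zero (image_eq_zero_of_notMem_tsupport hw)
  have hg_eq : ∫ w, G w = g := by
    ext z
    rw [hg, ContinuousMap.integral_apply hG_int]
    rfl
  exact hg_eq ▸ integral_mem_of_isClosed_submodule (S := S.toSubmodule)
    (Subalgebra.isClosed_topologicalClosure _) hG_mem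

theorem mem_closure_polynomialFunctions_of_differentiableOn {Ω : Set ℂ} (hΩ : IsOpen Ω)
    (hKΩ : fillHoles K ⊆ Ω) {f : ℂ → ℂ} (hf : DifferentiableOn ℂ f Ω) {g : C(K, ℂ)}
    (hg : ∀ z : K, g z = f z) : g ∈ (polynomialFunctions K).topologicalClosure := by
  have hK : IsCompact K := isCompact_iff_compactSpace.mpr inferInstance
  obtain ⟨u, hu, huc, huf⟩ := exists_contDiff_hasCompactSupport_eventuallyEq_nhdsSet (n := 1) hΩ
    ((hf.contDiffOn hΩ).restrict_scalars ℝ) (isCompact_fillHoles hK) hKΩ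
  set S := (polynomialFunctions K).topologicalClosure
  have hdisj : Disjoint (fillHoles K) (tsupport (dbar u)) := disjoint_left.mpr fun z hz => by
    have huf_z : u =ᶠ[𝓝 z] f := eventually_nhdsSet_iff_forall.mp huf z hz
    rw [notMem_tsupport_iff_eventuallyEq]
    filter_upwards [huf_z.eventuallyEq_nhds,
      hΩ.mem_nhds (hKΩ hz)] with w hw hwΩ
    rw [dbar_congr hw, Pi.zero_apply,
      dbar_eq_zero_of_differentiableAt (hf.differentiableAt (hΩ.mem_nhds hwΩ))]
  have hpi : -(Real.pi : ℂ) ≠ 0 := by simp [Real.pi_ne_zero]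
  have hmem : -(Real.pi : ℂ) • g ∈ S := by
    refine cauchyTransform_mem_closure_polynomialFunctions (continuous_dbar hu)
      (huc.of_isClosed_subset (isClosed_tsupport _) (tsupport_dbar_subset u)) hdisj fun z => ?_
    have huz : u z = f z := huf.self_of_nhdsSet (subset_fillHoles K z.2)
    rw [ContinuousMap.smul_apply, hg, ← huz, ← integral_inv_sub_smul_dbar hu huc]
    simp only [smul_eq_mul, mul_comm]
  rw [← inv_smul_smul₀ hpi g]
  exact S.smul_mem hmem _

end Runge

section Dirichlet

theorem differentiable_dirichletPolynomial (N : ℕ) (a : ℕ → ℂ) :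
    Differentiable ℂ (dirichletPolynomial N a) := by
  unfold dirichletPolynomial
  refine Differentiable.fun_sum fun n hn => ?_
  have hn_ne : (n : ℂ) ≠ 0 :=
    Nat.cast_ne_zero.mpr (Nat.one_le_iff_ne_zero.mp (Finset.mem_Icc.mp hn).1)
  exact (differentiable_neg.const_cpow (Or.inl hn_ne)).const_mul _

theorem dirichletPolynomial_eq_sum_range (N : ℕ) (a : ℕ → ℂ) (s : ℂ) :
    dirichletPolynomial N a s = ∑ n ∈ Finset.range N, a (n + 1) * ((n + 1 : ℕ) : ℂ) ^ (-s) := by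
  rw [dirichletPolynomial, Finset.range_eq_Ico,
    Finset.sum_Ico_add' (fun n : ℕ => a n * (n : ℂ) ^ (-s)) 0 N 1]
  rfl

/-- The Dirichlet monomial `s ↦ (n + 1)^{-s}` on `K`. The index is shifted so that it ranges over
all natural numbers without meeting the junk values of `0 ^ (-s)`. -/
noncomputable def dirichletMonomial (K : Set ℂ) (n : ℕ) : C(K, ℂ) where
  toFun s := ((n + 1 : ℕ) : ℂ) ^ (-(s : ℂ))
  continuous_toFun := by
    have : ((n + 1 : ℕ) : ℂ) ≠ 0 := Nat.cast_ne_zero.mpr n.succ_ne_zero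
    fun_prop (disch := simp [*])

variable {K : Set ℂ}

theorem exists_dirichletPolynomial_of_mem_span {g : C(K, ℂ)}
    (hg : g ∈ Submodule.span ℂ (range (dirichletMonomial K))) :
    ∃ (N : ℕ) (a : ℕ → ℂ), ∀ s : K, g s = dirichletPolynomial N a s := by
  obtain ⟨c, rfl⟩ := Finsupp.mem_span_range_iff_exists_finsupp.mp hg
  obtain ⟨N, hN⟩ := c.support.exists_nat_subset_range
  refine ⟨N, fun n => c (n - 1), fun s => ?_⟩
  rw [Finsupp.sum_of_support_subset c hN _ (by simp), ContinuousMap.sum_apply,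
    dirichletPolynomial_eq_sum_range]
  rfl

variable [CompactSpace K]

theorem dirichletMonomial_eq_exp (n : ℕ) : dirichletMonomial K n =
    NormedSpace.exp (-(Real.log (n + 1) : ℂ) • Polynomial.X.toContinuousMapOn K) := by
  let _ : NormedAlgebra ℚ C(K, ℂ) := NormedAlgebra.restrictScalars ℚ ℂ C(K, ℂ)
  ext s
  have hexp := NormedSpace.map_exp (ContinuousMap.evalAlgHom ℂ ℂ s) (continuous_eval_const s)
    (-(Real.log (n + 1) : ℂ) • Polynomial.X.toContinuousMapOn K)
  refine Eq.trans ?_ hexp.symm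
  change ((n + 1 : ℕ) : ℂ) ^ (-(s : ℂ)) = _
  rw [← exp_eq_exp_ℂ, cpow_def_of_ne_zero (Nat.cast_ne_zero.mpr n.succ_ne_zero)]
  congr 1
  simp [ofReal_log n.cast_add_one_pos.le]

theorem polynomialFunctions_le_closure_span_dirichletMonomial :
    (polynomialFunctions K).toSubmodule ≤
      (Submodule.span ℂ (range (dirichletMonomial K))).topologicalClosure := by
  have hpow (k : ℕ) : Polynomial.X.toContinuousMapOn K ^ k ∈
      (Submodule.span ℂ (range (dirichletMonomial K))).topologicalClosure := by
    rw [funext dirichletMonomial_eq_exp]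
    exact pow_mem_closure_span_exp_neg_log_smul _ k
  rintro _ ⟨P, -, rfl⟩
  change Polynomial.toContinuousMapOnAlgHom K P ∈ _
  rw [P.as_sum_range_C_mul_X_pow, map_sum]
  refine sum_mem fun k _ => ?_
  rw [← Polynomial.smul_eq_C_mul, map_smul, map_pow]
  exact Submodule.smul_mem _ _ (hpow k)

theorem exists_dirichletPolynomial_dist_lt {g : C(K, ℂ)}
    (hg : g ∈ (polynomialFunctions K).topologicalClosure) {ε : ℝ} (hε : 0 < ε) :
    ∃ (N : ℕ) (a : ℕ → ℂ), ∀ s : K, dist (g s) (dirichletPolynomial N a s) < ε := by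
  obtain ⟨d, hd, hgd⟩ := Metric.mem_closure_iff.mp
    (Submodule.topologicalClosure_minimal _ polynomialFunctions_le_closure_span_dirichletMonomial
      (Submodule.isClosed_topologicalClosure _) hg) ε hε
  obtain ⟨N, a, hda⟩ := exists_dirichletPolynomial_of_mem_span hd
  exact ⟨N, a, fun s => hda s ▸ (ContinuousMap.dist_lt_iff hε).mp hgd s⟩

end Dirichlet

theorem dense_dirichletPolynomials_of_forall_exists_dist_lt {Ω : Set ℂ}
    (h : ∀ f : ℂ → ℂ, DifferentiableOn ℂ f Ω → ∀ K ⊆ Ω, IsCompact K → ∀ ε > 0,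
      ∃ (N : ℕ) (a : ℕ → ℂ), ∀ s ∈ K, dist (f s) (dirichletPolynomial N a s) < ε) :
    Dense (dirichletPolynomials Ω) := by
  rintro ⟨f, F, hF, hfF⟩
  rw [mem_closure_iff_nhds]
  intro t ht
  obtain ⟨u, hu, hut⟩ := (mem_nhds_subtype _ _ _).mp ht
  obtain ⟨⟨K, ε⟩, ⟨hK, hε⟩, hKu⟩ := (nhds_basis_uniformity'
    Metric.uniformity_basis_dist.compactConvergenceUniformity).mem_iff.mp hu
  obtain ⟨N, a, ha⟩ := h F hF (Subtype.val '' K) (Subtype.coe_image_subset Ω K)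
    (hK.image continuous_subtype_val) ε hε
  have hP := differentiable_dirichletPolynomial N a
  refine ⟨⟨⟨fun s => dirichletPolynomial N a s, hP.continuous.comp continuous_subtype_val⟩,
    dirichletPolynomial N a, hP.differentiableOn, fun _ => rfl⟩, hut (hKu fun s hs => ?_),
    N, a, fun _ => rfl⟩
  change dist (f s) (dirichletPolynomial N a s) < ε
  rw [hfF]
  exact ha s (mem_image_of_mem _ hs)

theorem mainTheorem8_general {Ω : Set ℂ} (hΩ : IsOpen Ω)
    (hfill : ∀ K ⊆ Ω, IsCompact K → fillHoles K ⊆ Ω) : Dense (dirichletPolynomials Ω) := by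
  refine dense_dirichletPolynomials_of_forall_exists_dist_lt fun f hf K hKΩ hK ε hε => ?_
  have : CompactSpace K := isCompact_iff_compactSpace.mp hK
  let g : C(K, ℂ) := ⟨K.domRestrict f, (hf.continuousOn.mono hKΩ).domRestrict⟩
  have hg : g ∈ (polynomialFunctions K).topologicalClosure :=
    mem_closure_polynomialFunctions_of_differentiableOn hΩ (hfill K hKΩ hK) hf fun _ => rfl
  obtain ⟨N, a, hga⟩ := exists_dirichletPolynomial_dist_lt hg hε
  exact ⟨N, a, fun s hs => hga ⟨s, hs⟩⟩

theorem mainTheorem8 (Ω : Set ℂ) (hΩ : IsOpen Ω) (hsc : IsSimplyConnected Ω) :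
    Dense (dirichletPolynomials Ω) :=
  mainTheorem8_general hΩ fun _ hKΩ hK =>
    fillHoles_subset_of_isSimplyConnected hΩ hsc hK.isClosed hKΩ
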